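/- Let $I$ be a finite system of linear inequalities $a\cdot x\le b$ in $n\ge 2$ variables, with integer coefficients of arbitrary magnitude, that has no solution in $\{0,1\}^n$. A tree-like Cutting Planes proof of the unsatisfiability of $I$ is a finite tree of such inequalities whose leaves are inequalities of $I$ or the bounds $0\le x_i$, $x_i\le 1$, in which every other inequality follows from its children by one of the rules - addition: from $a_1\cdot x\le b_1$ and $a_2\cdot x\le b_2$ infer $(a_1+a_2)\cdot x\le b_1+b_2$; - scalar multiplication: from $a\cdot x\le b$ infer $d(a\cdot x)\le db$, where $d\in\mathbb N$ (for a negative integer $d$ one infers $d(a\cdot x)\ge db$, which is the same as multiplying by $-d$); - rounded division: from $d(a\cdot x)\le b$, where $d\ge 1$ is an integer and $a$ is an integer vector, infer $a\cdot x\le\lfloor b/d\rfloor$; and whose root is a false inequality $0\le b$ with $b<0$. Its size is the number of its nodes; the coefficients are unbounded. Given a partition of the variables into two parts $P_1,P_2$, in the Karchmer–Wigderson game of $I$ Alice receives the projection onto $P_1$ and Bob the projection onto $P_2$ of an assignment $\alpha\in\{0,1\}^n$, and they have to find an inequality of $I$ falsified by $\alpha$. The game requires $t$ bits of randomized communication with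 error $\varepsilon$ if every public-coin protocol (with finitely many fair coin flips, the answer being determined by the coins and the transcript) that on every input errs with probability at most $\varepsilon$ exchanges at least $t$ bits in the worst case. Theorem. For every $k\in\mathbb N$ there is a constant $c>0$, depending only on $k$, such that the following holds for all $n\ge 2$, all systems $I$ as above, and all $\varepsilon\ge n^{-k}$ (in particular for any fixed error such as $\varepsilon=1/3$, for which $k=2$ will do). If for some partition of the $n$ variables the Karchmer–Wigderson game of $I$ requires $t$ bits of randomized communication with error $\varepsilon$, then every tree-like Cutting Planes proof of the unsatisfiability of $I$ has size at least $2^{c\,t/\log_2 n}$. -/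

import Mathlib

namespace TreeCuttingPlanes

/-- A linear inequality `a · x ≤ b` in `n` variables, with arbitrary integer coefficients.
An inequality `a · x ≥ b` is written as `(-a) · x ≤ -b`. -/
structure LinIneq (n : ℕ) where
  coeff : Fin n → ℤ
  bound : ℤ

/-- The 0-1 assignment `α` satisfies the inequality. -/
def LinIneq.Holds {n : ℕ} (l : LinIneq n) (α : Fin n → Bool) : Prop :=
  ∑ i, l.coeff i * ((α i).toNat : ℤ) ≤ l.bound

/-- The system has no 0-1 solution. -/
def Unsatisfiable {n : ℕ} (I : Finset (LinIneq n)) : Prop :=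
  ∀ α : Fin n → Bool, ∃ l ∈ I, ¬ l.Holds α

/-- Tree-like Cutting Planes derivations from the system `I`, indexed by the derived inequality.
The tree structure of the inductive type is the tree structure of the proof: an inequality that is
used twice has to be derived twice. The leaves are inequalities of `I` or the 0-1 bounds
`0 ≤ x_i`, `x_i ≤ 1`. Multiplication of `a · x ≤ b` by a negative integer `d` yields
`d (a · x) ≥ d b`, which in the form used here is the result of multiplication by `-d : ℕ`. -/
inductive TreeCP {n : ℕ} (I : Finset (LinIneq n)) : LinIneq n → Type
  | ax (l : LinIneq n) (hl : l ∈ I) : TreeCP I l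
  | lower (i : Fin n) : TreeCP I ⟨Pi.single i (-1), 0⟩
  | upper (i : Fin n) : TreeCP I ⟨Pi.single i 1, 1⟩
  | add {a₁ a₂ : Fin n → ℤ} {b₁ b₂ : ℤ} (p : TreeCP I ⟨a₁, b₁⟩) (q : TreeCP I ⟨a₂, b₂⟩) :
      TreeCP I ⟨fun i => a₁ i + a₂ i, b₁ + b₂⟩
  | mul {a : Fin n → ℤ} {b : ℤ} (d : ℕ) (p : TreeCP I ⟨a, b⟩) :
      TreeCP I ⟨fun i => (d : ℤ) * a i, (d : ℤ) * b⟩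
  | div {a : Fin n → ℤ} {b : ℤ} (d : ℕ) (hd : 0 < d)
      (p : TreeCP I ⟨fun i => (d : ℤ) * a i, b⟩) :
      TreeCP I ⟨a, ⌊(b : ℚ) / (d : ℚ)⌋⟩

/-- The size of a tree-like derivation: the number of inequalities (nodes of the tree). -/
def TreeCP.size {n : ℕ} {I : Finset (LinIneq n)} {l : LinIneq n} (p : TreeCP I l) : ℕ :=
  match p with
  | .ax _ _ => 1
  | .lower _ => 1
  | .upper _ => 1
  | .add p q => p.size + q.size + 1
  | .mul _ p => p.size + 1
  | .div _ _ p => p.size + 1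

/-- An arithmetically false inequality: `0 ≤ b` with `b < 0`. -/
def LinIneq.IsFalse {n : ℕ} (l : LinIneq n) : Prop :=
  (∀ i, l.coeff i = 0) ∧ l.bound < 0

/-- A deterministic two-party protocol: a binary tree in which every inner node is owned by one of
the players, who sends a bit that depends on that player's own input (and on the node, that is, on
the transcript so far); every leaf is labelled with the answer. -/
inductive Protocol (X Y Z : Type) : Type
  | leaf (z : Z) : Protocol X Y Z
  | alice (f : X → Bool) (p₀ p₁ : Protocol X Y Z) : Protocol X Y Z
  | bob (g : Y → Bool) (p₀ p₁ : Protocol X Y Z) : Protocol X Y Z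

/-- The answer that the protocol gives on the input pair `(x, y)`. -/
def Protocol.eval {X Y Z : Type} (p : Protocol X Y Z) (x : X) (y : Y) : Z :=
  match p with
  | .leaf z => z
  | .alice f p₀ p₁ => if f x then p₁.eval x y else p₀.eval x y
  | .bob g p₀ p₁ => if g y then p₁.eval x y else p₀.eval x y

/-- The number of bits exchanged in the worst case. -/
def Protocol.depth {X Y Z : Type} (p : Protocol X Y Z) : ℕ :=
  match p with
  | .leaf _ => 0
  | .alice _ p₀ p₁ => max p₀.depth p₁.depth + 1
  | .bob _ p₀ p₁ => max p₀.depth p₁.depth + 1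

/-- A randomized protocol in the public-coin model: both players see a string of `coins` fair coin
flips, and then follow the deterministic protocol that belongs to it. -/
structure PublicCoinProtocol (X Y Z : Type) where
  coins : ℕ
  protocol : (Fin coins → Bool) → Protocol X Y Z

/-- The number of bits exchanged in the worst case, over all inputs and all coin flips. -/
def PublicCoinProtocol.cost {X Y Z : Type} (Q : PublicCoinProtocol X Y Z) : ℕ :=
  Finset.univ.sup fun r => (Q.protocol r).depth

/-- On every input pair `(x, y)` the probability, over the coin flips, of an answer `z` for which
`R x y z` fails is at most `ε`. -/
def PublicCoinProtocol.SolvesWithError {X Y Z : Type} (Q : PublicCoinProtocol X Y Z)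
    (R : X → Y → Z → Prop) (ε : ℝ) : Prop :=
  ∀ x y, (Nat.card {r : Fin Q.coins → Bool // ¬ R x y ((Q.protocol r).eval x y)} : ℝ)
    / 2 ^ Q.coins ≤ ε

/-- Every public-coin protocol that solves `R` with error at most `ε` exchanges at least `t` bits
in the worst case. -/
def RequiresRandomizedBits {X Y Z : Type} (R : X → Y → Z → Prop) (ε : ℝ) (t : ℕ) : Prop :=
  ∀ Q : PublicCoinProtocol X Y Z, Q.SolvesWithError R ε → t ≤ Q.cost

/-- The assignment whose projections onto `P` and onto the complement of `P` are `x` and `y`. -/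
def glue {n : ℕ} (P : Finset (Fin n)) (x : {i // i ∈ P} → Bool) (y : {i // i ∉ P} → Bool) :
    Fin n → Bool :=
  fun i => if h : i ∈ P then x ⟨i, h⟩ else y ⟨i, h⟩

/-- The Karchmer-Wigderson game of the system `I` for the partition of the variables into `P`
(Alice's part) and its complement (Bob's part): find an inequality of `I` that is falsified. -/
def KWGame {n : ℕ} (I : Finset (LinIneq n)) (P : Finset (Fin n))
    (x : {i // i ∈ P} → Bool) (y : {i // i ∉ P} → Bool) (l : {l // l ∈ I}) : Prop :=
  ¬ l.1.Holds (glue P x y)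

end TreeCuttingPlanes

namespace TreeCuttingPlanes

/-! A proof of size `S` is turned into a protocol with `O(log S · log n)` bits and error at most `n
^ (-k)`; here `O` depends on `k`. At a 0-1 assignment the root of the proof is false, so some leaf
is false, and it must be an inequality of `I`. Halting at any line and asking whether it holds
allows the tree to be searched in a balanced way: `LabeledTree.exists_decisionTree` finds a false
leaf with `O(log S)` queries.

A query asks whether Alice's part of a linear form is at most the bound minus Bob's part. The
coefficients may be huge, but only the order matters, and Alice has at most `2 ^ n` inputs;
`exists_rank` replaces the two integers by ranks of `n + 2` bits. To compare these, the players look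
for the first digit in which they differ, by binary search on common prefixes with hashed equality
tests. The tests are noisy, but a search that can go back needs only `O(log n)` tests for
polynomially small error (`card_search_fail_le`). A union bound over the queries gives
`TreeCP.exists_protocol`. When `S > 2 ^ n`, announcing all variables is cheap enough. -/

/-- Run `p`, then continue with the protocol that its answer selects. -/
def Protocol.bind {X Y Z W : Type} (p : Protocol X Y Z) (k : Z → Protocol X Y W) :
    Protocol X Y W :=
  match p with
  | .leaf z => k z
  | .alice f p₀ p₁ => .alice f (p₀.bind k) (p₁.bind k)
  | .bob g p₀ p₁ => .bob g (p₀.bind k) (p₁.bind k)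

theorem Protocol.eval_bind {X Y Z W : Type} (p : Protocol X Y Z) (k : Z → Protocol X Y W)
    (x : X) (y : Y) : (p.bind k).eval x y = (k (p.eval x y)).eval x y := by
  induction p with
  | leaf z => rfl
  | alice f p₀ p₁ h₀ h₁ => simp only [bind, eval]; split_ifs <;> assumption
  | bob g p₀ p₁ h₀ h₁ => simp only [bind, eval]; split_ifs <;> assumption

theorem Protocol.depth_bind_le {X Y Z W : Type} (p : Protocol X Y Z) (k : Z → Protocol X Y W)
    {m : ℕ} (hk : ∀ z, (k z).depth ≤ m) : (p.bind k).depth ≤ p.depth + m := by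
  induction p with
  | leaf z => simpa [bind, depth] using hk z
  | alice f p₀ p₁ h₀ h₁ => simp only [bind, depth]; omega
  | bob g p₀ p₁ h₀ h₁ => simp only [bind, depth]; omega

/-! ### Balanced search in a proof tree -/

/-- Binary trees whose nodes and leaves carry a label. -/
inductive LabeledTree (L : Type) : Type
  | leaf (l : L) : LabeledTree L
  | node (l : L) (a b : LabeledTree L) : LabeledTree L

namespace LabeledTree

variable {L : Type}

/-- The label at the root. -/
def label : LabeledTree L → L
  | leaf l => l
  | node l _ _ => l

/-- The number of leaves. -/
def numLeaves : LabeledTree L → ℕ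
  | leaf _ => 1
  | node _ a b => a.numLeaves + b.numLeaves

/-- The labels of the leaves. -/
def leaves : LabeledTree L → Set L
  | leaf l => {l}
  | node _ a b => a.leaves ∪ b.leaves

/-- Every inner node whose two children hold itself holds. -/
def Sound (H : L → Prop) : LabeledTree L → Prop
  | leaf _ => True
  | node l a b => (H a.label → H b.label → H l) ∧ a.Sound H ∧ b.Sound H

theorem one_le_numLeaves (t : LabeledTree L) : 1 ≤ t.numLeaves := by
  induction t with
  | leaf l => exact le_rfl
  | node l a b ha hb => simp only [numLeaves]; omega

/-- A tree with more than `m` leaves either has few leaves, or splits into a subtree `s` with few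
leaves and a rest `r` that keeps the soundness, and the failure at the root, when the label of `s`
holds. -/
theorem exists_split (m : ℕ) (t : LabeledTree L) (ht : m < t.numLeaves) :
    t.numLeaves ≤ max (2 * m) 1 ∨
    ∃ s r : LabeledTree L, m < s.numLeaves ∧ s.numLeaves ≤ max (2 * m) 1 ∧
      s.numLeaves + r.numLeaves = t.numLeaves ∧ s.leaves ⊆ t.leaves ∧ r.leaves ⊆ t.leaves ∧
      ∀ H : L → Prop, t.Sound H → s.Sound H ∧
        (H s.label → r.Sound H ∧ (H r.label → H t.label)) := by
  induction t with
  | leaf l => left; simp [numLeaves]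
  | node l a b iha ihb =>
    by_cases ha : m < a.numLeaves
    · right
      rcases iha ha with h | ⟨s, r, h1, h2, h3, h4, h5, h6⟩
      -- Once `a` is known to hold, it can be cut off and its sibling `b` put in place of their
      -- parent.
      · exact ⟨a, b, ha, h, rfl, Set.subset_union_left, Set.subset_union_right,
          fun H hH => ⟨hH.2.1, fun hs => ⟨hH.2.2, hH.1 hs⟩⟩⟩
      · refine ⟨s, node l r b, h1, h2, by simp only [numLeaves]; omega,
          h4.trans Set.subset_union_left, Set.union_subset_union_left _ h5, fun H hH => ?_⟩
        obtain ⟨hs, hr⟩ := h6 H hH.2.1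
        exact ⟨hs, fun h => ⟨⟨fun h' => hH.1 ((hr h).2 h'), (hr h).1, hH.2.2⟩, id⟩⟩
    · by_cases hb : m < b.numLeaves
      · right
        rcases ihb hb with h | ⟨s, r, h1, h2, h3, h4, h5, h6⟩
        · exact ⟨b, a, hb, h, by simp only [numLeaves]; omega, Set.subset_union_right,
            Set.subset_union_left, fun H hH => ⟨hH.2.2, fun hs => ⟨hH.2.1, fun h' => hH.1 h' hs⟩⟩⟩
        · refine ⟨s, node l a r, h1, h2, by simp only [numLeaves]; omega,
            h4.trans Set.subset_union_right, Set.union_subset_union_right _ h5, fun H hH => ?_⟩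
          obtain ⟨hs, hr⟩ := h6 H hH.2.2
          exact ⟨hs, fun h => ⟨⟨fun h' h'' => hH.1 h' ((hr h).2 h''), hH.2.1, (hr h).1⟩, id⟩⟩
      · left
        simp only [numLeaves]; omega

end LabeledTree

/-- Decision trees that query whether a line holds and finally answer with a line. -/
inductive DecisionTree (L : Type) : Type
  | answer (l : L) : DecisionTree L
  | query (l : L) (d₀ d₁ : DecisionTree L) : DecisionTree L

/-- The answer of the decision tree if the queries are answered according to `H`. -/
def DecisionTree.eval {L : Type} (H : L → Bool) : DecisionTree L → L
  | answer l => l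
  | query l d₀ d₁ => if H l then d₁.eval H else d₀.eval H

/-- The largest number of queries on a branch. -/
def DecisionTree.depth {L : Type} : DecisionTree L → ℕ
  | answer _ => 0
  | query _ d₀ d₁ => max d₀.depth d₁.depth + 1

/-- Whenever a sound tree fails at its root, a leaf that fails is found with a number of queries
logarithmic in the number of leaves. -/
theorem LabeledTree.exists_decisionTree {L : Type} (D : ℕ) (t : LabeledTree L)
    (ht : t.numLeaves * 2 ^ D ≤ 3 ^ D) :
    ∃ d : DecisionTree L, d.depth ≤ D ∧ ∀ H : L → Bool, t.Sound (fun l => H l = true) →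
      H t.label = false → d.eval H ∈ t.leaves ∧ H (d.eval H) = false := by
  induction D generalizing t with
  | zero =>
    cases t with
    | leaf l => exact ⟨.answer l, le_rfl, fun H _ h => ⟨rfl, h⟩⟩
    | node l a b =>
      have := a.one_le_numLeaves
      have := b.one_le_numLeaves
      simp only [numLeaves] at ht
      omega
  | succ D ih =>
    rcases t.exists_split (t.numLeaves / 3) (by have := t.one_le_numLeaves; omega) with
      h | ⟨s, r, h1, h2, h3, h4, h5, h6⟩
    · cases t with
      | leaf l => exact ⟨.answer l, Nat.zero_le _, fun H _ h => ⟨rfl, h⟩⟩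
      | node l a b =>
        have := a.one_le_numLeaves
        have := b.one_le_numLeaves
        simp only [numLeaves] at h
        omega
    · have hr := r.one_le_numLeaves
      -- Each query leaves at most two thirds of the leaves: `s` by its upper bound, `r` because `s`
      -- has more than a third.
      have key : ∀ u : ℕ, 3 * u ≤ 2 * t.numLeaves → u * 2 ^ D ≤ 3 ^ D := fun u hu => by
        have := Nat.mul_le_mul_right (2 ^ D) hu
        rw [pow_succ, pow_succ] at ht
        nlinarith
      obtain ⟨ds, hds, hs⟩ := ih s (key _ (by omega))
      obtain ⟨dr, hdr, hr⟩ := ih r (key _ (by omega))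
      refine ⟨.query s.label ds dr, by simp only [DecisionTree.depth]; omega, fun H hS hf => ?_⟩
      obtain ⟨hs', hr'⟩ := h6 _ hS
      simp only [DecisionTree.eval]
      split_ifs with hq
      · obtain ⟨hr1, hr2⟩ := hr' hq
        have := hr H hr1 (by
          by_contra hc
          have := hr2 (by simpa using hc)
          simp [hf] at this)
        exact ⟨h5 this.1, this.2⟩
      · have := hs H hs' (by simpa using hq)
        exact ⟨h4 this.1, this.2⟩

/-! ### Cutting Planes derivations as trees -/

/-- The binary tree of a derivation, in which the unary inferences are contracted. -/
def TreeCP.toTree {n : ℕ} {I : Finset (LinIneq n)} {l : LinIneq n} (p : TreeCP I l) :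
    LabeledTree (LinIneq n) :=
  match p with
  | .ax l _ => .leaf l
  | .lower i => .leaf ⟨Pi.single i (-1), 0⟩
  | .upper i => .leaf ⟨Pi.single i 1, 1⟩
  | @TreeCP.add _ _ a₁ a₂ b₁ b₂ p q => .node ⟨fun i => a₁ i + a₂ i, b₁ + b₂⟩ p.toTree q.toTree
  | .mul _ p => p.toTree
  | .div _ _ p => p.toTree

theorem TreeCP.numLeaves_toTree_le {n : ℕ} {I : Finset (LinIneq n)} {l : LinIneq n}
    (p : TreeCP I l) : p.toTree.numLeaves ≤ p.size := by
  induction p <;> simp only [toTree, size, LabeledTree.numLeaves] <;> omega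

/-- Contraction leaves at the root a premise of the final unary inferences, so the label may differ
from `l`. Rounding is sound because the linear form is an integer at a 0-1 point. -/
theorem TreeCP.holds_of_label_toTree {n : ℕ} {I : Finset (LinIneq n)} {l : LinIneq n}
    (p : TreeCP I l) (α : Fin n → Bool) (h : p.toTree.label.Holds α) : l.Holds α := by
  induction p with
  | ax l hl => exact h
  | lower i => exact h
  | upper i => exact h
  | add p q => exact h
  | @mul a b d p ih =>
    have := ih h
    simp only [LinIneq.Holds, mul_assoc, ← Finset.mul_sum] at this ⊢
    exact mul_le_mul_of_nonneg_left this (by positivity)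
  | @div a b d hd p ih =>
    have := ih h
    simp only [LinIneq.Holds, mul_assoc, ← Finset.mul_sum] at this ⊢
    rw [Int.le_floor, le_div_iff₀ (by exact_mod_cast hd), mul_comm]
    exact_mod_cast this

theorem TreeCP.sound_toTree {n : ℕ} {I : Finset (LinIneq n)} {l : LinIneq n}
    (p : TreeCP I l) (α : Fin n → Bool) : p.toTree.Sound (fun l => l.Holds α) := by
  induction p with
  | ax l hl => trivial
  | lower i => trivial
  | upper i => trivial
  | @add a₁ a₂ b₁ b₂ p q ihp ihq =>
    refine ⟨fun hp hq => ?_, ihp, ihq⟩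
    have h₁ := p.holds_of_label_toTree α hp
    have h₂ := q.holds_of_label_toTree α hq
    simp only [LinIneq.Holds, add_mul, Finset.sum_add_distrib] at h₁ h₂ ⊢
    exact add_le_add h₁ h₂
  | mul d p ih => exact ih
  | div d hd p ih => exact ih

/-- The other leaves are the 0-1 bounds, which no assignment falsifies. -/
theorem TreeCP.mem_of_mem_leaves_toTree {n : ℕ} {I : Finset (LinIneq n)} {l : LinIneq n}
    (p : TreeCP I l) (α : Fin n → Bool) (l' : LinIneq n) (hl' : l' ∈ p.toTree.leaves)
    (h : ¬ l'.Holds α) : l' ∈ I := by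
  induction p with
  | ax l hl =>
    obtain rfl : l' = l := hl'
    exact hl
  | lower i =>
    obtain rfl := Set.mem_singleton_iff.1 hl'
    refine absurd ?_ h
    cases hα : α i <;> simp [LinIneq.Holds, Pi.single_apply, ite_mul, hα]
  | upper i =>
    obtain rfl := Set.mem_singleton_iff.1 hl'
    refine absurd ?_ h
    cases hα : α i <;> simp [LinIneq.Holds, Pi.single_apply, ite_mul, hα]
  | add p q ihp ihq => exact hl'.elim ihp ihq
  | mul d p ih => exact ih hl'
  | div d hd p ih => exact ih hl'

/-! ### Binary search with noisy tests -/

/-- The left end of the `c`-th of the `2 ^ d` dyadic parts of `[0, 2 ^ K)`, rounded down. -/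
def dyadicLevel (K d c : ℕ) : ℕ := c * 2 ^ K / 2 ^ d

/-- One step of the backtracking search. The state `(d, c)` stands for the `c`-th dyadic part at
depth `d`. If its right end fails the test, the step goes back to the parent; otherwise it moves
to the half selected by a test at the midpoint. -/
def searchStep (K : ℕ) (test : ℕ → Bool) (s : ℕ × ℕ) : ℕ × ℕ :=
  if test (dyadicLevel K s.1 (s.2 + 1)) then
    if test (dyadicLevel K (s.1 + 1) (2 * s.2 + 1)) then (s.1 + 1, 2 * s.2)
    else (s.1 + 1, 2 * s.2 + 1)
  else (s.1 - 1, s.2 / 2)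

/-- The backtracking search with a fresh random test in every step. -/
def search {Ω : Type} (K : ℕ) (test : Ω → ℕ → Bool) :
    (T : ℕ) → (Fin T → Ω) → ℕ × ℕ → ℕ × ℕ
  | 0, _, s => s
  | T + 1, ω, s => search K test T (Fin.tail ω) (searchStep K (test (ω 0)) s)

open Classical in
/-- A potential that falls by a factor `3` with every correct step of the search. -/
noncomputable def searchWeight (K : ℕ) (E : ℕ → Prop) : ℕ → ℕ → ℝ
  | 0, _ => 1
  | d + 1, c => searchWeight K E d (c / 2) * if E (dyadicLevel K (d + 1) (c + 1)) then 1 / 3 else 3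

theorem dyadicLevel_two_mul (K d c : ℕ) : dyadicLevel K (d + 1) (2 * c) = dyadicLevel K d c := by
  rw [dyadicLevel, dyadicLevel, pow_succ', mul_assoc, Nat.mul_div_mul_left _ _ two_pos]

theorem dyadicLevel_mono (K d : ℕ) {c c' : ℕ} (h : c ≤ c') :
    dyadicLevel K d c ≤ dyadicLevel K d c' :=
  Nat.div_le_div_right (Nat.mul_le_mul_right _ h)

theorem dyadicLevel_eq_div {K d : ℕ} (h : K ≤ d) (c : ℕ) :
    dyadicLevel K d c = c / 2 ^ (d - K) := by
  obtain ⟨e, rfl⟩ := Nat.exists_eq_add_of_le h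
  rw [dyadicLevel, pow_add, mul_comm c, Nat.mul_div_mul_left _ _ (by positivity),
    Nat.add_sub_cancel_left]

theorem searchWeight_pos (K : ℕ) (E : ℕ → Prop) (d c : ℕ) : 0 < searchWeight K E d c := by
  induction d generalizing c with
  | zero => exact one_pos
  | succ d ih =>
    rw [searchWeight]
    refine mul_pos (ih _) ?_
    split_ifs <;> norm_num

theorem searchWeight_ge (K : ℕ) (E : ℕ → Prop) (d c : ℕ) :
    (1 / 3 : ℝ) ^ d ≤ searchWeight K E d c := by
  induction d generalizing c with
  | zero => simp [searchWeight]
  | succ d ih =>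
    rw [searchWeight, pow_succ]
    refine mul_le_mul (ih _) ?_ (by norm_num) (searchWeight_pos ..).le
    split_ifs <;> norm_num

theorem searchWeight_succ_le (K : ℕ) (E : ℕ → Prop) (d c : ℕ) :
    searchWeight K E (d + 1) c ≤ 3 * searchWeight K E d (c / 2) := by
  rw [searchWeight, mul_comm]
  refine mul_le_mul_of_nonneg_right ?_ (searchWeight_pos ..).le
  split_ifs <;> norm_num

/-- A small potential locates the threshold of `E`. -/
theorem of_searchWeight_lt {K : ℕ} {E : ℕ → Prop} (hE : Monotone E) (d c : ℕ)
    (h : searchWeight K E d c < (1 / 3) ^ K) : E (dyadicLevel K d c + 1) := by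
  have hd : ∀ d c, searchWeight K E d c < (1 / 3) ^ K → K < d := fun d c h => by
    by_contra! hc
    exact absurd ((pow_le_pow_of_le_one (by norm_num) (by norm_num) hc).trans
      (searchWeight_ge K E d c)) (not_le.2 h)
  induction d generalizing c with
  | zero => exact absurd (hd _ _ h) (by omega)
  | succ d ih =>
    have hK := hd _ _ h
    -- A weight below `(1 / 3) ^ K` forces depth beyond `K`, where a part lies between consecutive
    -- integers. If the right end is bad, the parent has a still smaller weight and the same left
    -- level.
    by_cases hg : E (dyadicLevel K (d + 1) (c + 1))
    · refine hE ?_ hg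
      rw [dyadicLevel_eq_div hK.le, dyadicLevel_eq_div hK.le]
      calc (c + 1) / 2 ^ (d + 1 - K) ≤ (c + 2 ^ (d + 1 - K)) / 2 ^ (d + 1 - K) :=
            Nat.div_le_div_right (Nat.add_le_add_left Nat.one_le_two_pow _)
        _ = _ := Nat.add_div_right _ (by positivity)
    · rw [searchWeight, if_neg hg] at h
      have h' : searchWeight K E d (c / 2) < (1 / 3) ^ K := by
        have := searchWeight_pos K E d (c / 2)
        linarith
      have := ih _ h'
      rw [dyadicLevel_eq_div (hd _ _ h').le, Nat.div_div_eq_div_mul, ← pow_succ',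
        ← Nat.sub_add_comm (hd _ _ h').le] at this
      rwa [dyadicLevel_eq_div hK.le]

/-- The states that the search can reach when a failing test is always right. -/
def SearchInv (K : ℕ) (E : ℕ → Prop) (s : ℕ × ℕ) : Prop :=
  s.2 < 2 ^ s.1 ∧ ¬ E (dyadicLevel K s.1 s.2)

section

variable {K : ℕ} {E : ℕ → Prop} (hE : Monotone E) (hK : E (2 ^ K))

include hK in
theorem SearchInv.pos {s : ℕ × ℕ} (hs : SearchInv K E s)
    (h : ¬ E (dyadicLevel K s.1 (s.2 + 1))) : 0 < s.1 := by
  rcases s with ⟨d, c⟩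
  by_contra! hd
  obtain rfl : d = 0 := by simpa using hd
  obtain rfl : c = 0 := by simpa using hs.1
  exact h (by simpa [dyadicLevel] using hK)

-- The left end only moves right after a failing test, which is trustworthy; going back moves it
-- left, which is harmless by monotonicity.
include hE hK in
theorem SearchInv.step {s : ℕ × ℕ} (hs : SearchInv K E s) {test : ℕ → Bool}
    (ht : ∀ j, E j → test j = true) : SearchInv K E (searchStep K test s) := by
  rw [searchStep]
  split_ifs with h1 h2
  · exact ⟨by have := hs.1; simp only [pow_succ]; omega, by
      simpa only [dyadicLevel_two_mul] using hs.2⟩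
  · exact ⟨by have := hs.1; simp only [pow_succ]; omega, fun h => h2 (ht _ h)⟩
  · have hpos := hs.pos hK fun h => h1 (ht _ h)
    rcases s with ⟨d, c⟩
    obtain ⟨d, rfl⟩ := Nat.exists_eq_succ_of_ne_zero hpos.ne'
    refine ⟨?_, fun h => hs.2 (hE ?_ h)⟩
    · have := hs.1
      simp only [Nat.succ_eq_add_one, pow_succ, Nat.add_sub_cancel] at this ⊢
      omega
    · simp only [Nat.succ_eq_add_one, Nat.add_sub_cancel]
      rw [← dyadicLevel_two_mul]
      exact dyadicLevel_mono _ _ (by omega)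

-- In each state at most one test can do harm by passing wrongly: the right end if it is bad,
-- otherwise the midpoint. A correct step divides the weight by 3, a wrong one multiplies it by at
-- most 3. The point `j` depends on the state only, not on the coins.
include hK in
theorem exists_searchWeight_step_le {s : ℕ × ℕ} (hs : SearchInv K E s) :
    ∃ j, ¬ E j ∧ ∀ test : ℕ → Bool, (∀ j, E j → test j = true) →
      searchWeight K E (searchStep K test s).1 (searchStep K test s).2 ≤
        searchWeight K E s.1 s.2 * (1 / 3 + 3 * if test j = true then 1 else 0) := by
  have hW := searchWeight_pos K E s.1 s.2
  have hl : ∀ c, 2 * c / 2 = c := fun c => by omega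
  have hr : ∀ c, (2 * c + 1) / 2 = c := fun c => by omega
  by_cases h : E (dyadicLevel K s.1 (s.2 + 1))
  · by_cases hm : E (dyadicLevel K (s.1 + 1) (2 * s.2 + 1))
    -- Both tests are sure to pass here; the left end serves as a dummy `j`.
    · refine ⟨_, hs.2, fun test ht => ?_⟩
      rw [searchStep, if_pos (ht _ h), if_pos (ht _ hm)]
      simp only [searchWeight, if_pos hm, hl]
      refine mul_le_mul_of_nonneg_left ?_ hW.le
      split_ifs <;> norm_num
    · refine ⟨_, hm, fun test ht => ?_⟩
      rw [searchStep, if_pos (ht _ h)]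
      split_ifs with h2
      · have := searchWeight_succ_le K E s.1 (2 * s.2)
        rw [hl] at this
        simp only
        linarith
      · have : E (dyadicLevel K (s.1 + 1) (2 * s.2 + 1 + 1)) := by
          rw [show 2 * s.2 + 1 + 1 = 2 * (s.2 + 1) by ring, dyadicLevel_two_mul]
          exact h
        simp only [searchWeight, if_pos this, hr]
        linarith
  · refine ⟨_, h, fun test ht => ?_⟩
    rw [searchStep]
    split_ifs with h1 h2
    · have := searchWeight_succ_le K E s.1 (2 * s.2)
      rw [hl] at this
      simp only
      linarith
    · have := searchWeight_succ_le K E s.1 (2 * s.2 + 1)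
      rw [hr] at this
      simp only
      linarith
    · have hpos := hs.pos hK h
      rcases s with ⟨d, c⟩
      obtain ⟨d, rfl⟩ := Nat.exists_eq_succ_of_ne_zero hpos.ne'
      simp only [Nat.succ_eq_add_one, Nat.add_sub_cancel] at h ⊢
      rw [searchWeight, if_neg h]
      linarith

variable {Ω : Type} {test : Ω → ℕ → Bool} (ht : ∀ ω j, E j → test ω j = true)

include hE hK ht in
theorem SearchInv.search {s : ℕ × ℕ} (hs : SearchInv K E s) (T : ℕ) (ω : Fin T → Ω) :
    SearchInv K E (search K test T ω s) := by
  induction T generalizing s with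
  | zero => exact hs
  | succ T ih => exact ih (hs.step hE hK (ht _)) _

variable [Fintype Ω] (hq : ∀ j, ¬ E j → 32 * Nat.card {ω // test ω j = true} ≤ Fintype.card Ω)

-- Fresh coins in each step make the factors multiply: the weight shrinks on average by `1 / 3 + 3 /
-- 32 < 1 / 2`.
include hE hK ht hq in
theorem sum_searchWeight_le {s : ℕ × ℕ} (hs : SearchInv K E s) (T : ℕ) :
    ∑ ω : Fin T → Ω, searchWeight K E (search K test T ω s).1 (search K test T ω s).2 ≤
      searchWeight K E s.1 s.2 * (Fintype.card Ω / 2) ^ T := by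
  induction T generalizing s with
  | zero => simp [TreeCuttingPlanes.search]
  | succ T ih =>
    rw [← (Fin.consEquiv fun _ => Ω).sum_comp, Fintype.sum_prod_type]
    simp only [Fin.consEquiv_apply, TreeCuttingPlanes.search, Fin.cons_zero]
    refine (Finset.sum_le_sum fun ω _ => ih (hs.step hE hK (ht ω))).trans ?_
    rw [← Finset.sum_mul, pow_succ', ← mul_assoc]
    refine mul_le_mul_of_nonneg_right ?_ (by positivity)
    obtain ⟨j, hj, hstep⟩ := exists_searchWeight_step_le hK hs
    refine (Finset.sum_le_sum fun ω _ => hstep _ (ht ω)).trans ?_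
    rw [← Finset.mul_sum]
    refine mul_le_mul_of_nonneg_left ?_ (searchWeight_pos ..).le
    rw [Finset.sum_add_distrib, ← Finset.mul_sum, Finset.sum_boole]
    have := hq j hj
    rw [Nat.card_eq_fintype_card, Fintype.card_subtype] at this
    have h' : 32 * ((Finset.univ.filter fun ω => test ω j = true).card : ℝ) ≤ Fintype.card Ω := by
      exact_mod_cast this
    simp only [Finset.sum_const, Finset.card_univ, nsmul_eq_mul]
    linarith

include hE hK ht hq in
/-- The backtracking search finds the threshold of a monotone predicate, up to a probability
exponentially small in the number of steps, when the tests never err on one side and err with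
probability at most `1 / 32` on the other. -/
theorem card_search_fail_le (h0 : ¬ E 0) (T : ℕ) :
    (Nat.card {ω : Fin T → Ω // ¬ (¬ E (dyadicLevel K (search K test T ω (0, 0)).1
        (search K test T ω (0, 0)).2) ∧ E (dyadicLevel K (search K test T ω (0, 0)).1
        (search K test T ω (0, 0)).2 + 1))} : ℝ) ≤ 3 ^ K * (Fintype.card Ω / 2) ^ T := by
  classical
  have hs : SearchInv K E (0, 0) := ⟨by simp, by simpa [dyadicLevel] using h0⟩
  have hsum := sum_searchWeight_le hE hK ht hq hs T
  rw [Nat.card_eq_fintype_card, Fintype.card_subtype]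
  set F := Finset.univ.filter fun ω : Fin T → Ω => ¬ (¬ E (dyadicLevel K
    (search K test T ω (0, 0)).1 (search K test T ω (0, 0)).2) ∧ E (dyadicLevel K
    (search K test T ω (0, 0)).1 (search K test T ω (0, 0)).2 + 1)) with hF
  -- Markov's inequality: a failing run ends with weight at least `(1 / 3) ^ K`.
  have h1 : ∑ _ω ∈ F, (1 / 3 : ℝ) ^ K ≤
      ∑ ω : Fin T → Ω, searchWeight K E (search K test T ω (0, 0)).1
        (search K test T ω (0, 0)).2 := by
    refine (Finset.sum_le_sum fun ω hω => ?_).trans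
      (Finset.sum_le_univ_sum_of_nonneg fun ω => (searchWeight_pos ..).le)
    by_contra! hlt
    exact (Finset.mem_filter.1 hω).2 ⟨(hs.search hE hK ht T ω).2, of_searchWeight_lt hE _ _ hlt⟩
  rw [Finset.sum_const, nsmul_eq_mul] at h1
  have h2 := h1.trans hsum
  simp only [searchWeight, one_mul] at h2
  calc (F.card : ℝ) = 3 ^ K * (F.card * (1 / 3) ^ K) := by
        rw [mul_left_comm, ← mul_pow]; norm_num
    _ ≤ _ := mul_le_mul_of_nonneg_left h2 (by positivity)

end

/-! ### Equality tests by random hashing -/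

/-- The players compare their values under each of a list of functions. -/
def eqTest {X Y V : Type} (a : X → V) (b : Y → V) : List (V → Bool) → Protocol X Y Bool
  | [] => .leaf true
  | h :: hs => .alice (fun x => h (a x))
      (.bob (fun y => h (b y)) (eqTest a b hs) (.leaf false))
      (.bob (fun y => h (b y)) (.leaf false) (eqTest a b hs))

theorem eqTest_eval {X Y V : Type} (a : X → V) (b : Y → V) (hs : List (V → Bool)) (x : X) (y : Y) :
    (eqTest a b hs).eval x y = decide (∀ h ∈ hs, h (a x) = h (b y)) := by
  induction hs with
  | nil => simp [eqTest, Protocol.eval]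
  | cons h hs ih =>
    cases ha : h (a x) <;> cases hb : h (b y) <;> simp [eqTest, Protocol.eval, ih, ha, hb]

theorem eqTest_depth {X Y V : Type} (a : X → V) (b : Y → V) (hs : List (V → Bool)) :
    (eqTest a b hs).depth ≤ 2 * hs.length := by
  induction hs with
  | nil => simp [eqTest, Protocol.depth]
  | cons h hs ih => simp only [eqTest, Protocol.depth, List.length_cons]; omega

/-- A function that separates two given points does so for half of all functions. -/
theorem two_mul_card_eq_apply {V : Type} [Fintype V] [DecidableEq V] {a b : V} (hab : a ≠ b) :
    2 * (Finset.univ.filter fun h : V → Bool => h a = h b).card = Fintype.card (V → Bool) := by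
  have h1 : (Finset.univ.filter fun h : V → Bool => h a = h b).card =
      (Finset.univ.filter fun h : V → Bool => ¬ h a = h b).card := by
    -- Flipping the value at `a` is an involution that exchanges collisions and separations.
    refine Finset.card_bij' (fun h _ => Function.update h a (!h a))
      (fun h _ => Function.update h a (!h a)) ?_ ?_ ?_ ?_
    · intro h hh
      have := (Finset.mem_filter.1 hh).2
      simp [Function.update_of_ne hab.symm, this]
    · intro h hh
      have := (Finset.mem_filter.1 hh).2
      simp only [Finset.mem_filter, Finset.mem_univ, true_and, Function.update_self,
        Function.update_of_ne hab.symm]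
      revert this
      cases h a <;> cases h b <;> simp
    · intro h _; simp
    · intro h _; simp
  have h2 := Finset.card_filter_add_card_filter_not (s := (Finset.univ : Finset (V → Bool)))
    (fun h => h a = h b)
  rw [Finset.card_univ] at h2
  omega

/-- The coins of one test: five functions with random bits as values. -/
abbrev HashCoins (V : Type) : Type := Fin 5 → V → Bool

theorem card_hash_collision {V : Type} [Fintype V] [DecidableEq V] {a b : V} (hab : a ≠ b) :
    32 * Nat.card {ω : HashCoins V // decide (∀ h ∈ List.ofFn ω, h a = h b) = true} ≤
      Fintype.card (HashCoins V) := by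
  have h1 : (Finset.univ.filter fun ω : HashCoins V =>
      decide (∀ h ∈ List.ofFn ω, h a = h b) = true) =
      Fintype.piFinset fun _ : Fin 5 => Finset.univ.filter fun h : V → Bool => h a = h b := by
    ext ω
    simp only [decide_eq_true_eq, Finset.mem_filter, Finset.mem_univ, true_and,
      Fintype.mem_piFinset, List.forall_mem_ofFn_iff]
  rw [Nat.card_eq_fintype_card, Fintype.card_subtype, h1, Fintype.card_piFinset,
    show Fintype.card (HashCoins V) = Fintype.card (V → Bool) ^ 5 by
      rw [Fintype.card_fun (α := Fin 5), Fintype.card_fin], ← two_mul_card_eq_apply hab]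
  simp only [Finset.prod_const, Finset.card_univ, Fintype.card_fin]
  rw [mul_pow]
  norm_num

/-! ### Comparison of two numbers -/

/-- The number without its last `j` binary digits. -/
def shift {M : ℕ} (a : Fin M) (j : ℕ) : Fin M :=
  ⟨a / 2 ^ j, (Nat.div_le_self _ _).trans_lt a.2⟩

theorem shift_eq_mono {M : ℕ} (a b : Fin M) : Monotone fun j => shift a j = shift b j := by
  intro i j hij h
  obtain ⟨e, rfl⟩ := Nat.exists_eq_add_of_le hij
  have h : (a : ℕ) / 2 ^ i = b / 2 ^ i := by simpa [shift] using h
  simp only [shift, pow_add, ← Nat.div_div_eq_div_mul, h]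

/-- The two prefixes differ in their last digit only, so Alice's digit alone reveals the order. -/
theorem lt_iff_of_shift {M : ℕ} {a b : Fin M} {j : ℕ} (h : shift a j ≠ shift b j)
    (h' : shift a (j + 1) = shift b (j + 1)) : a < b ↔ (a : ℕ) / 2 ^ j % 2 = 0 := by
  simp only [shift, ne_eq, Fin.mk.injEq, pow_succ, ← Nat.div_div_eq_div_mul] at h h'
  have h1 : a < b ↔ (a : ℕ) / 2 ^ j < b / 2 ^ j := by
    constructor
    · intro hlt
      exact lt_of_le_of_ne (Nat.div_le_div_right (le_of_lt hlt)) h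
    · intro hlt
      by_contra! hc
      exact absurd (Nat.div_le_div_right (c := 2 ^ j) (Fin.le_def.1 hc)) (not_le.2 hlt)
  rw [h1]
  omega

/-- The protocol that runs `search` on the lengths of the common prefixes of two numbers. -/
def searchProtocol {X Y : Type} {M : ℕ} (K : ℕ) (a : X → Fin M) (b : Y → Fin M) :
    (T : ℕ) → (Fin T → HashCoins (Fin M)) → ℕ × ℕ → Protocol X Y (ℕ × ℕ)
  | 0, _, s => .leaf s
  | T + 1, ω, s =>
    let test := fun j => eqTest (fun x => shift (a x) j) (fun y => shift (b y) j) (List.ofFn (ω 0))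
    -- Both tests may share coins, as the analysis charges only one of them.
    (test (dyadicLevel K s.1 (s.2 + 1))).bind fun t =>
      (test (dyadicLevel K (s.1 + 1) (2 * s.2 + 1))).bind fun t' =>
        searchProtocol K a b T (Fin.tail ω)
          (if t then if t' then (s.1 + 1, 2 * s.2) else (s.1 + 1, 2 * s.2 + 1)
            else (s.1 - 1, s.2 / 2))

theorem searchProtocol_eval {X Y : Type} {M : ℕ} (K : ℕ) (a : X → Fin M) (b : Y → Fin M) (T : ℕ)
    (ω : Fin T → HashCoins (Fin M)) (s : ℕ × ℕ) (x : X) (y : Y) :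
    (searchProtocol K a b T ω s).eval x y = search K (fun ω j =>
      decide (∀ h ∈ List.ofFn ω, h (shift (a x) j) = h (shift (b y) j))) T ω s := by
  induction T generalizing s with
  | zero => rfl
  | succ T ih =>
    simp only [searchProtocol, Protocol.eval_bind, eqTest_eval, ih, search, searchStep,
      decide_eq_true_eq]

theorem searchProtocol_depth {X Y : Type} {M : ℕ} (K : ℕ) (a : X → Fin M) (b : Y → Fin M) (T : ℕ)
    (ω : Fin T → HashCoins (Fin M)) (s : ℕ × ℕ) :
    (searchProtocol K a b T ω s).depth ≤ 20 * T := by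
  induction T generalizing s with
  | zero => simp [searchProtocol, Protocol.depth]
  | succ T ih =>
    have htest : ∀ j, (eqTest (fun x => shift (a x) j) (fun y => shift (b y) j)
        (List.ofFn (ω 0))).depth ≤ 10 := fun j => by
      simpa using eqTest_depth (fun x => shift (a x) j) (fun y => shift (b y) j) (List.ofFn (ω 0))
    refine (Protocol.depth_bind_le _ _ fun t => Protocol.depth_bind_le _ _ fun t' => ih _ _).trans ?_
    have h1 := htest (dyadicLevel K s.1 (s.2 + 1))
    have h2 := htest (dyadicLevel K (s.1 + 1) (2 * s.2 + 1))
    simp only at h1 h2 ⊢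
    omega

/-- Alice and Bob decide which of their numbers is larger. -/
def compareProtocol {X Y : Type} {M : ℕ} (K : ℕ) (a : X → Fin M) (b : Y → Fin M) (T : ℕ)
    (ω : Fin T → HashCoins (Fin M)) : Protocol X Y Bool :=
  (searchProtocol K a b T ω (0, 0)).bind fun s =>
    .alice (fun x => decide ((a x : ℕ) / 2 ^ dyadicLevel K s.1 s.2 % 2 = 0))
      (.leaf false) (.leaf true)

theorem compareProtocol_depth {X Y : Type} {M : ℕ} (K : ℕ) (a : X → Fin M) (b : Y → Fin M) (T : ℕ)
    (ω : Fin T → HashCoins (Fin M)) : (compareProtocol K a b T ω).depth ≤ 20 * T + 1 :=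
  (Protocol.depth_bind_le _ _ (m := 1) fun s => by simp [Protocol.depth]).trans
    (Nat.add_le_add_right (searchProtocol_depth ..) _)

/-- The comparison of two different numbers below `2 ^ 2 ^ K` errs with probability exponentially
small in the number of steps. -/
theorem card_compareProtocol_fail_le {X Y : Type} {M K : ℕ} (hM : M ≤ 2 ^ 2 ^ K) (a : X → Fin M)
    (b : Y → Fin M) (T : ℕ) (x : X) (y : Y) (hxy : a x ≠ b y) :
    (Nat.card {ω : Fin T → HashCoins (Fin M) //
      (compareProtocol K a b T ω).eval x y ≠ decide (a x < b y)} : ℝ) ≤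
      3 ^ K * (Fintype.card (HashCoins (Fin M)) / 2) ^ T := by
  refine le_trans ?_ (card_search_fail_le (K := K) (test := fun (ω : HashCoins (Fin M)) j =>
      decide (∀ h ∈ List.ofFn ω, h (shift (a x) j) = h (shift (b y) j)))
      (shift_eq_mono (a x) (b y)) ?_ ?_ ?_ ?_ T)
  · norm_cast
    refine Nat.card_le_card_of_injective (fun ω => ⟨ω.1, fun h => ω.2 ?_⟩) fun ω ω' h =>
      Subtype.ext (congrArg (fun z => z.1) h)
    rw [compareProtocol, Protocol.eval_bind, searchProtocol_eval]
    simp only [Protocol.eval, lt_iff_of_shift h.1 h.2]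
    split_ifs with h' <;> simp_all
  · have : ∀ c : Fin M, (c : ℕ) / 2 ^ 2 ^ K = 0 := fun c => Nat.div_eq_of_lt (c.2.trans_le hM)
    simp [shift, this]
  · intro ω j h
    simp [h]
  · intro j h
    exact card_hash_collision h
  · simpa [shift, Fin.ext_iff] using hxy

/-- The comparison of an integer known to Alice with one known to Bob amounts to the comparison of
two different natural numbers bounded in terms of the number of Alice's inputs. -/
theorem exists_rank {X Y : Type} [Fintype X] (u : X → ℤ) (v : Y → ℤ) {M : ℕ}
    (hM : 2 * Fintype.card X < M) :
    ∃ (a : X → Fin M) (b : Y → Fin M), ∀ x y, a x ≠ b y ∧ (u x ≤ v y ↔ a x < b y) := by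
  classical
  have hlt : ∀ x, (Finset.univ.filter fun x' => u x' < u x).card < Fintype.card X := fun x =>
    Finset.card_lt_univ_of_notMem (x := x) (by simp)
  have hle : ∀ y, (Finset.univ.filter fun x' => u x' ≤ v y).card ≤ Fintype.card X := fun y =>
    Finset.card_le_univ _
  -- Odd values for Alice and even ones for Bob rule out ties. If `u x ≤ v y`, then `x` itself makes
  -- Bob's count strictly larger.
  refine ⟨fun x => ⟨2 * (Finset.univ.filter fun x' => u x' < u x).card + 1, ?_⟩,
    fun y => ⟨2 * (Finset.univ.filter fun x' => u x' ≤ v y).card, ?_⟩, fun x y => ⟨?_, ?_⟩⟩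
  · have := hlt x; omega
  · have := hle y; omega
  · simp only [ne_eq, Fin.mk.injEq]; omega
  · rw [Fin.mk_lt_mk]
    constructor
    · intro h
      have : (Finset.univ.filter fun x' => u x' < u x).card <
          (Finset.univ.filter fun x' => u x' ≤ v y).card := by
        refine Finset.card_lt_card ((Finset.ssubset_iff_of_subset ?_).2 ⟨x, by simpa using h, by simp⟩)
        exact Finset.monotone_filter_right _ fun x' _ h' => h'.le.trans h
      omega
    · intro h
      by_contra! hc
      have := Finset.card_le_card (Finset.monotone_filter_right (Finset.univ : Finset X)
        (p := fun x' => u x' ≤ v y) (q := fun x' => u x' < u x) fun x' _ h' => lt_of_le_of_lt h' hc)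
      omega

/-! ### From decision trees to protocols -/

/-- The queries that the decision tree makes if they are answered according to `H`. -/
def DecisionTree.queries {L : Type} (H : L → Bool) : DecisionTree L → List L
  | answer _ => []
  | query l d₀ d₁ => l :: if H l then d₁.queries H else d₀.queries H

theorem DecisionTree.length_queries_le {L : Type} (H : L → Bool) (d : DecisionTree L) :
    (d.queries H).length ≤ d.depth := by
  induction d with
  | answer l => exact le_rfl
  | query l d₀ d₁ h₀ h₁ =>
    simp only [queries, depth, List.length_cons]
    split_ifs <;> omega

/-- The protocol that answers the queries of a decision tree by the protocols `q`. -/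
def DecisionTree.toProtocol {L X Y Z : Type} (q : L → Protocol X Y Bool) (ans : L → Z) :
    DecisionTree L → Protocol X Y Z
  | answer l => .leaf (ans l)
  | query l d₀ d₁ => (q l).bind fun t => if t then d₁.toProtocol q ans else d₀.toProtocol q ans

theorem DecisionTree.toProtocol_depth {L X Y Z : Type} (q : L → Protocol X Y Bool) (ans : L → Z)
    {G : ℕ} (hq : ∀ l, (q l).depth ≤ G) (d : DecisionTree L) :
    (d.toProtocol q ans).depth ≤ d.depth * G := by
  induction d with
  | answer l => simp [toProtocol, Protocol.depth]
  | query l d₀ d₁ h₀ h₁ =>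
    have h₀' := h₀.trans (Nat.mul_le_mul_right G (le_max_left d₀.depth d₁.depth))
    have h₁' := h₁.trans (Nat.mul_le_mul_right G (le_max_right d₀.depth d₁.depth))
    refine (Protocol.depth_bind_le (q l) _ (m := max d₀.depth d₁.depth * G) fun t => ?_).trans ?_
    · cases t <;> simpa
    · rw [depth, Nat.succ_mul, add_comm]
      exact Nat.add_le_add_left (hq l) _

/-- Only the queries on the true branch have to be answered correctly. This branch is fixed by the
input, so the union bound runs over one branch and not over the whole tree. -/
theorem DecisionTree.toProtocol_eval {L X Y Z : Type} (q : L → Protocol X Y Bool) (ans : L → Z)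
    (H : L → Bool) (x : X) (y : Y) (d : DecisionTree L)
    (h : ∀ l ∈ d.queries H, (q l).eval x y = H l) :
    (d.toProtocol q ans).eval x y = ans (d.eval H) := by
  induction d with
  | answer l => rfl
  | query l d₀ d₁ h₀ h₁ =>
    simp only [queries, List.mem_cons, forall_eq_or_imp] at h
    simp only [toProtocol, Protocol.eval_bind, h.1, eval]
    split_ifs with hl
    · exact h₁ (by simpa [hl] using h.2)
    · exact h₀ (by simpa [hl] using h.2)

/-- The union bound along a list. -/
theorem card_not_forall_mem_le {Ω L : Type} [Finite Ω] (good : L → Ω → Prop) {B : ℝ}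
    (hB : ∀ l, (Nat.card {ω // ¬ good l ω} : ℝ) ≤ B) (ls : List L) :
    (Nat.card {ω // ¬ ∀ l ∈ ls, good l ω} : ℝ) ≤ ls.length * B := by
  classical
  have := Fintype.ofFinite Ω
  simp only [Nat.card_eq_fintype_card, Fintype.card_subtype] at hB ⊢
  induction ls with
  | nil => simp
  | cons l ls ih =>
    have hsub : (Finset.univ.filter fun ω => ¬ ∀ l' ∈ l :: ls, good l' ω) ⊆
        (Finset.univ.filter fun ω => ¬ good l ω) ∪
          Finset.univ.filter fun ω => ¬ ∀ l' ∈ ls, good l' ω := by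
      intro ω
      simp only [List.mem_cons, forall_eq_or_imp, not_and_or, Finset.mem_filter, Finset.mem_univ,
        true_and, Finset.mem_union, imp_self]
    have hcard : ((Finset.univ.filter fun ω => ¬ ∀ l' ∈ l :: ls, good l' ω).card : ℝ) ≤
        (Finset.univ.filter fun ω => ¬ good l ω).card +
          (Finset.univ.filter fun ω => ¬ ∀ l' ∈ ls, good l' ω).card := by
      exact_mod_cast (Finset.card_le_card hsub).trans (Finset.card_union_le _ _)
    rw [List.length_cons, Nat.cast_succ, add_mul, one_mul]
    linarith [hB l]

/-- The truth of an inequality is the comparison of a number of Alice with a number of Bob. -/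
theorem LinIneq.exists_compare {n : ℕ} (P : Finset (Fin n)) (l : LinIneq n) :
    ∃ (a : ({i // i ∈ P} → Bool) → Fin (2 ^ (n + 2))) (b : ({i // i ∉ P} → Bool) → Fin (2 ^ (n + 2))),
      ∀ x y, a x ≠ b y ∧ (l.Holds (glue P x y) ↔ a x < b y) := by
  obtain ⟨a, b, hab⟩ := exists_rank (M := 2 ^ (n + 2))
    (fun x : {i // i ∈ P} → Bool => ∑ i : {i // i ∈ P}, l.coeff i * ((x i).toNat : ℤ))
    (fun y : {i // i ∉ P} → Bool =>
      l.bound - ∑ i : {i // i ∉ P}, l.coeff i * ((y i).toNat : ℤ)) (by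
      have : P.card ≤ n := by simpa using P.card_le_univ
      have := Nat.pow_le_pow_right two_pos this
      have := Nat.two_pow_pos n
      rw [Fintype.card_fun, Fintype.card_bool, Fintype.card_coe, pow_add]
      omega)
  refine ⟨a, b, fun x y => ⟨(hab x y).1, ?_⟩⟩
  rw [← (hab x y).2, le_sub_iff_add_le, LinIneq.Holds,
    ← Fintype.sum_subtype_add_sum_subtype (fun i => i ∈ P)]
  refine iff_of_eq (congrArg (· ≤ l.bound) (congrArg₂ (· + ·) ?_ ?_))
  · exact Finset.sum_congr (by ext; simp) fun i _ => by rw [glue, dif_pos i.2]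
  · exact Finset.sum_congr (by ext; simp) fun i _ => by rw [glue, dif_neg i.2]

/-- A refutation yields a randomized protocol for the Karchmer-Wigderson game. -/
theorem TreeCP.exists_protocol {n : ℕ} {I : Finset (LinIneq n)} (hI : I.Nonempty)
    (P : Finset (Fin n)) {l : LinIneq n} (hl : l.IsFalse) (p : TreeCP I l) {D K T : ℕ}
    (hD : p.size * 2 ^ D ≤ 3 ^ D) (hK : n + 2 ≤ 2 ^ K) :
    ∃ Q : PublicCoinProtocol ({i // i ∈ P} → Bool) ({i // i ∉ P} → Bool) {l // l ∈ I},
      Q.SolvesWithError (KWGame I P) (D * 3 ^ K / 2 ^ T) ∧ Q.cost ≤ D * (20 * T + 1) := by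
  classical
  obtain ⟨l₀, hl₀⟩ := hI
  let ans : LinIneq n → {l // l ∈ I} := fun l => if h : l ∈ I then ⟨l, h⟩ else ⟨l₀, hl₀⟩
  obtain ⟨d, hd, hdec⟩ := p.toTree.exists_decisionTree D
    ((Nat.mul_le_mul_right _ p.numLeaves_toTree_le).trans hD)
  choose a b hab using LinIneq.exists_compare (n := n) P
  let Ω := Fin T → HashCoins (Fin (2 ^ (n + 2)))
  let e : (Fin (Fintype.card (Fin T × Fin 5 × Fin (2 ^ (n + 2)))) → Bool) ≃ Ω :=
    ((Fintype.equivFin _).symm.arrowCongr (Equiv.refl Bool)).trans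
      ((Equiv.curry _ _ _).trans ((Equiv.refl _).arrowCongr (Equiv.curry _ _ _)))
  -- All queries reuse the same coins; a union bound needs no independence.
  let prot : Ω → Protocol ({i // i ∈ P} → Bool) ({i // i ∉ P} → Bool) {l // l ∈ I} := fun ω =>
    d.toProtocol (fun l => compareProtocol K (a l) (b l) T ω) ans
  refine ⟨⟨_, fun r => prot (e r)⟩, fun x y => ?_, ?_⟩
  · set H : LinIneq n → Bool := fun l => decide (l.Holds (glue P x y)) with hH
    have hcoins : ((2 : ℝ) ^ Fintype.card (Fin T × Fin 5 × Fin (2 ^ (n + 2)))) =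
        (Fintype.card (HashCoins (Fin (2 ^ (n + 2)))) : ℝ) ^ T := by
      have := Fintype.card_congr e
      rw [Fintype.card_fun, Fintype.card_fun, Fintype.card_bool, Fintype.card_fin,
        Fintype.card_fin] at this
      exact_mod_cast this
    have hsound : p.toTree.Sound fun l => H l = true := by
      simpa only [hH, decide_eq_true_eq] using p.sound_toTree (glue P x y)
    have hroot : H p.toTree.label = false := by
      simp only [hH, decide_eq_false_iff_not]
      intro h
      have := p.holds_of_label_toTree _ h
      simp only [LinIneq.Holds, hl.1, zero_mul, Finset.sum_const_zero] at this
      exact absurd hl.2 (not_lt.2 this)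
    obtain ⟨hmem, hfalse⟩ := hdec H hsound hroot
    have hfalse : ¬ (d.eval H).Holds (glue P x y) := by simpa [hH] using hfalse
    have hmemI := p.mem_of_mem_leaves_toTree (glue P x y) _ hmem hfalse
    have hgood : ∀ ω : Ω, (∀ l ∈ d.queries H, (compareProtocol K (a l) (b l) T ω).eval x y = H l) →
        KWGame I P x y ((prot ω).eval x y) := fun ω hω => by
      rw [DecisionTree.toProtocol_eval _ _ H x y d hω]
      simp only [ans, dif_pos hmemI]
      exact hfalse
    have hcmp : ∀ l, (Nat.card {ω : Ω // ¬ (compareProtocol K (a l) (b l) T ω).eval x y = H l} : ℝ)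
        ≤ 3 ^ K * (Fintype.card (HashCoins (Fin (2 ^ (n + 2)))) / 2) ^ T := fun l => by
      have : H l = decide (a l x < b l y) := by simp only [hH, (hab l x y).2]
      rw [this]
      exact card_compareProtocol_fail_le (Nat.pow_le_pow_right two_pos hK) _ _ T x y (hab l x y).1
    have hunion := card_not_forall_mem_le _ hcmp (d.queries H)
    have hle : (Nat.card {r // ¬ KWGame I P x y ((prot (e r)).eval x y)} : ℝ) ≤
        Nat.card {ω : Ω // ¬ ∀ l ∈ d.queries H,
          (compareProtocol K (a l) (b l) T ω).eval x y = H l} := by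
      norm_cast
      refine Nat.card_le_card_of_injective (fun r => ⟨e r.1, fun h => r.2 (hgood _ h)⟩)
        fun r r' h => Subtype.ext (e.injective (congrArg (fun z => z.1) h))
    have hlen : ((d.queries H).length : ℝ) ≤ D := by
      exact_mod_cast (d.length_queries_le H).trans hd
    have hN : (0 : ℝ) < Fintype.card (HashCoins (Fin (2 ^ (n + 2)))) := by
      exact_mod_cast Fintype.card_pos
    refine (div_le_div_of_nonneg_right ((hle.trans hunion).trans
      (mul_le_mul_of_nonneg_right hlen (by positivity))) (by positivity)).trans_eq ?_
    simp only [hcoins, div_pow]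
    field_simp
  · refine Finset.sup_le fun r _ => (DecisionTree.toProtocol_depth _ _
      (fun l => compareProtocol_depth ..) d).trans (Nat.mul_le_mul_right _ hd)

/-! ### The trivial protocol for huge proofs -/

/-- The owners of the listed variables announce their values, which are entered into `α`. -/
def revealProtocol {n : ℕ} {Z : Type} (P : Finset (Fin n)) (ans : (Fin n → Bool) → Z) :
    List (Fin n) → (Fin n → Bool) → Protocol ({i // i ∈ P} → Bool) ({i // i ∉ P} → Bool) Z
  | [], α => .leaf (ans α)
  | i :: is, α =>
    let k := fun t => revealProtocol P ans is (Function.update α i t)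
    if h : i ∈ P then .alice (fun x => x ⟨i, h⟩) (k false) (k true)
    else .bob (fun y => y ⟨i, h⟩) (k false) (k true)

theorem revealProtocol_depth {n : ℕ} {Z : Type} (P : Finset (Fin n)) (ans : (Fin n → Bool) → Z)
    (is : List (Fin n)) (α : Fin n → Bool) : (revealProtocol P ans is α).depth ≤ is.length := by
  induction is generalizing α with
  | nil => simp [revealProtocol, Protocol.depth]
  | cons i is ih =>
    rw [revealProtocol]
    split_ifs <;> simp only [Protocol.depth, List.length_cons] <;>
      exact Nat.add_le_add_right (max_le (ih _) (ih _)) 1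

theorem revealProtocol_eval {n : ℕ} {Z : Type} (P : Finset (Fin n)) (ans : (Fin n → Bool) → Z)
    (x : {i // i ∈ P} → Bool) (y : {i // i ∉ P} → Bool) (is : List (Fin n)) (α : Fin n → Bool) :
    (revealProtocol P ans is α).eval x y =
      ans (fun j => if j ∈ is then glue P x y j else α j) := by
  induction is generalizing α with
  | nil => simp [revealProtocol, Protocol.eval]
  | cons i is ih =>
    have key : ∀ t, glue P x y i = t → (revealProtocol P ans is (Function.update α i t)).eval x y =
        ans (fun j => if j ∈ i :: is then glue P x y j else α j) := fun t ht => by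
      rw [ih]
      congr 1
      funext j
      by_cases hj : j = i
      · subst hj; simp [ht]
      · simp [hj]
    rw [revealProtocol]
    by_cases h : i ∈ P
    · rw [dif_pos h, Protocol.eval]
      split_ifs with hx
      · exact key true (by rw [glue, dif_pos h, hx])
      · exact key false (by rw [glue, dif_pos h]; simpa using hx)
    · rw [dif_neg h, Protocol.eval]
      split_ifs with hy
      · exact key true (by rw [glue, dif_neg h, hy])
      · exact key false (by rw [glue, dif_neg h]; simpa using hy)

theorem Unsatisfiable.exists_trivial_protocol {n : ℕ} {I : Finset (LinIneq n)}
    (hI : Unsatisfiable I) (P : Finset (Fin n)) :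
    ∃ Q : PublicCoinProtocol ({i // i ∈ P} → Bool) ({i // i ∉ P} → Bool) {l // l ∈ I},
      Q.SolvesWithError (KWGame I P) 0 ∧ Q.cost ≤ n := by
  choose f hf hf' using hI
  refine ⟨⟨0, fun _ => revealProtocol P (fun α => ⟨f α, hf α⟩) (List.finRange n) fun _ => false⟩,
    fun x y => ?_, Finset.sup_le fun r _ => (revealProtocol_depth ..).trans (by simp)⟩
  have : IsEmpty {r : Fin 0 → Bool // ¬ KWGame I P x y ((revealProtocol P
      (fun α => (⟨f α, hf α⟩ : {l // l ∈ I})) (List.finRange n) fun _ => false).eval x y)} :=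
    ⟨fun r => r.2 (by
      rw [revealProtocol_eval]
      simpa [KWGame] using hf' (glue P x y))⟩
  simp

theorem PublicCoinProtocol.SolvesWithError.mono {X Y Z : Type} {Q : PublicCoinProtocol X Y Z}
    {R : X → Y → Z → Prop} {ε ε' : ℝ} (h : Q.SolvesWithError R ε) (hε : ε ≤ ε') :
    Q.SolvesWithError R ε' :=
  fun x y => (h x y).trans hε

/-! ### Choice of parameters -/

/-- The number of bits is at most the product of the logarithms, up to a constant. -/
theorem requiresRandomizedBits_le (k : ℕ) {n : ℕ} (hn : 2 ≤ n) {I : Finset (LinIneq n)}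
    (hI : Unsatisfiable I) (P : Finset (Fin n)) {ε : ℝ} (hε : 1 / (n : ℝ) ^ k ≤ ε) {t : ℕ}
    (ht : RequiresRandomizedBits (KWGame I P) ε t) {l : LinIneq n} (hl : l.IsFalse)
    (p : TreeCP I l) (hp : p.size ≤ 2 ^ n) :
    t ≤ 2 * Nat.clog 2 p.size * (20 * ((k + 3) * Nat.clog 2 n + 3) + 1) := by
  set S := p.size
  set m := Nat.clog 2 n
  set D := 2 * Nat.clog 2 S with hDdef
  have hnm : n ≤ 2 ^ m := Nat.le_pow_clog one_lt_two n
  -- The factor 2 in `D` suffices because `2 * 4 ≤ 9`.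
  have hD : S * 2 ^ D ≤ 3 ^ D := by
    have h1 : S ≤ 2 ^ Nat.clog 2 S := Nat.le_pow_clog one_lt_two S
    rw [hDdef, pow_mul, pow_mul]
    calc S * (2 ^ 2) ^ Nat.clog 2 S ≤ 2 ^ Nat.clog 2 S * (2 ^ 2) ^ Nat.clog 2 S :=
          Nat.mul_le_mul_right _ h1
      _ = 8 ^ Nat.clog 2 S := by rw [← mul_pow]; norm_num
      _ ≤ (3 ^ 2) ^ Nat.clog 2 S := Nat.pow_le_pow_left (by norm_num) _
  have hDn : D ≤ 2 * 2 ^ m := by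
    have : Nat.clog 2 S ≤ n := Nat.clog_le_of_le_pow hp
    omega
  -- `K` is chosen so that `n + 2 ≤ 2 * n ≤ 2 ^ K`. With `D ≤ 2 * 2 ^ m` and `3 ^ K ≤ 4 ^ (m + 1)`,
  -- this `T` is exactly what brings the error down to `n ^ (-k)`.
  obtain ⟨Q, hQ, hcost⟩ := p.exists_protocol (K := m + 1) (T := (k + 3) * m + 3)
    ((hI fun _ => false).imp fun _ h => h.1) P hl hD (by rw [pow_succ]; omega)
  refine (ht Q (hQ.mono (le_trans ?_ hε))).trans hcost
  rw [div_le_div_iff₀ (by positivity) (by positivity), one_mul]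
  have h1 : D * 3 ^ (m + 1) * n ^ k ≤ 2 ^ ((k + 3) * m + 3) :=
    calc D * 3 ^ (m + 1) * n ^ k ≤ (2 * 2 ^ m) * 4 ^ (m + 1) * (2 ^ m) ^ k :=
          Nat.mul_le_mul (Nat.mul_le_mul hDn (Nat.pow_le_pow_left (by norm_num) _))
            (Nat.pow_le_pow_left hnm k)
      _ = 2 ^ ((k + 3) * m + 3) := by
          rw [show 4 = 2 ^ 2 by norm_num, ← pow_mul, ← pow_mul, ← pow_succ', ← pow_add, ← pow_add]
          congr 1
          ring
  exact_mod_cast h1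

theorem clog_le_two_mul_logb {m : ℕ} (hm : 2 ≤ m) : (Nat.clog 2 m : ℝ) ≤ 2 * Real.logb 2 m := by
  have h1 : 1 ≤ Real.logb 2 m := by
    rw [Real.le_logb_iff_rpow_le one_lt_two (by positivity), Real.rpow_one]
    exact_mod_cast hm
  have h2 : 2 ^ (Nat.clog 2 m - 1) < m := Nat.pow_pred_clog_lt_self one_lt_two hm
  have h3 : ((Nat.clog 2 m - 1 : ℕ) : ℝ) ≤ Real.logb 2 m := by
    rw [Real.le_logb_iff_rpow_le one_lt_two (by positivity), Real.rpow_natCast]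
    exact_mod_cast h2.le
  have h4 : (Nat.clog 2 m : ℝ) ≤ ((Nat.clog 2 m - 1 : ℕ) : ℝ) + 1 := by
    norm_cast
    omega
  linarith

end TreeCuttingPlanes

theorem mainTheorem1 (k : ℕ) :
    ∃ c : ℝ, 0 < c ∧
      ∀ (n : ℕ) (_ : 2 ≤ n)
        (I : Finset (TreeCuttingPlanes.LinIneq n)) (_ : TreeCuttingPlanes.Unsatisfiable I)
        (P : Finset (Fin n)) (ε : ℝ) (_ : 1 / (n : ℝ) ^ k ≤ ε) (t : ℕ)
        (_ : TreeCuttingPlanes.RequiresRandomizedBits (TreeCuttingPlanes.KWGame I P) ε t)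
        (l : TreeCuttingPlanes.LinIneq n) (_ : l.IsFalse) (p : TreeCuttingPlanes.TreeCP I l),
        (2 : ℝ) ^ (c * (t : ℝ) / Real.logb 2 (n : ℝ)) ≤ (p.size : ℝ) := by
  -- Each `clog` costs a factor 2 against `logb`, and `181 = 20 * 3 * 2 + 61` absorbs the additive
  -- terms since `logb 2 n ≥ 1`.
  refine ⟨1 / (4 * (40 * k + 181)), by positivity, fun n hn I hI P ε hε t ht l hl p => ?_⟩
  have hk : (0 : ℝ) ≤ k := Nat.cast_nonneg k
  have hlog : 1 ≤ Real.logb 2 n := by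
    rw [Real.le_logb_iff_rpow_le one_lt_two (by positivity), Real.rpow_one]
    exact_mod_cast hn
  have hS : 1 ≤ p.size := p.toTree.one_le_numLeaves.trans p.numLeaves_toTree_le
  rw [← Real.le_logb_iff_rpow_le one_lt_two (by exact_mod_cast hS),
    div_le_iff₀ (by linarith), one_div, inv_mul_le_iff₀ (by positivity)]
  have hlogS : 0 ≤ Real.logb 2 p.size := Real.logb_nonneg one_lt_two (by exact_mod_cast hS)
  rcases le_or_gt p.size (2 ^ n) with hp | hp
  · have h := TreeCuttingPlanes.requiresRandomizedBits_le k hn hI P hε ht hl p hp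
    have hm := TreeCuttingPlanes.clog_le_two_mul_logb hn
    have hD : (Nat.clog 2 p.size : ℝ) ≤ 2 * Real.logb 2 p.size := by
      -- Size 1 is separate: the bound on `clog` needs an argument of at least 2.
      rcases hS.eq_or_lt with h1 | h2
      · simp [← h1]
      · exact TreeCuttingPlanes.clog_le_two_mul_logb h2
    have hG : 20 * ((k + 3) * (Nat.clog 2 n : ℝ) + 3) + 1 ≤ (40 * k + 181) * Real.logb 2 n := by
      nlinarith [mul_le_mul_of_nonneg_left hm (by linarith : (0 : ℝ) ≤ k + 3)]
    calc (t : ℝ) ≤ 2 * Nat.clog 2 p.size * (20 * ((k + 3) * (Nat.clog 2 n : ℝ) + 3) + 1) := by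
          exact_mod_cast h
      _ ≤ 2 * (2 * Real.logb 2 p.size) * ((40 * k + 181) * Real.logb 2 n) := by
          gcongr
      _ = 4 * (40 * k + 181) * (Real.logb 2 p.size * Real.logb 2 n) := by ring
  · obtain ⟨Q, hQ, hcost⟩ := hI.exists_trivial_protocol P
    have htn : (t : ℝ) ≤ n := by
      exact_mod_cast (ht Q (hQ.mono (le_trans (by positivity) hε))).trans hcost
    have hnS : (n : ℝ) ≤ Real.logb 2 p.size := by
      rw [Real.le_logb_iff_rpow_le one_lt_two (by exact_mod_cast hS), Real.rpow_natCast]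
      exact_mod_cast hp.le
    have h1 : Real.logb 2 p.size ≤ Real.logb 2 p.size * Real.logb 2 n :=
      le_mul_of_one_le_right hlogS hlog
    have h2 : 0 ≤ Real.logb 2 p.size * Real.logb 2 n := by positivity
    nlinarith
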